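/- Let $\Omega\subset\mathbb R^3$ be a bounded polyhedral domain with Lipschitz boundary, let $\mathcal T_h$ be a tetrahedral triangulation of $\overline\Omega$ with totally ordered vertices $v_1,\dots,v_{n_v}$, and orient each edge $[v_a,v_b]$ from $v_a$ to $v_b$ for $a<b$. Let $\boldsymbol\eta$ be a symmetric matrix function with entries in $L^\infty(\Omega)$, uniformly positive definite in $\Omega$. Let $n_e$ be the number of edges, $n_Q=n_e-(n_v-1)$, and let $g$ be the rank of $\mathcal H_1(\overline\Omega,\mathbb Z)$. Choose a spanning tree of each connected component of the graph of the vertices and edges of $\mathcal T_h$ on $\partial\Omega$, and a spanning tree $S$ of the graph of all vertices and edges of $\mathcal T_h$ that contains these trees. Number the edges so that $e_1,\dots,e_{n_Q}$ are those not in $S$ and so that $e_1,\dots,e_{2g}$ lie on $\partial\Omega$ and satisfy the following: for $q=1,\dots,2g$ there is an integer 1-cycle $\gamma_q$ equal to $e_q$ plus a combination of edges of the boundary trees, and $\gamma_1,\dots,\gamma_{2g}$ represent a basis of $\mathcal H_1(\partial\Omega,\mathbb Z)$. Let $A_{n,q}\in\mathbb Z$ be such that the 1-cycles $\sigma_n=\sum_{q=1}^{2g}A_{n,q}\gamma_q$,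 $n=1,\dots,g$, represent a basis of $\mathcal H_1(\overline\Omega,\mathbb Z)$. Let $N_h\subset H(\mathrm{curl};\Omega)$ be the space of lowest-degree Nédélec edge elements, i.e. of the fields in $H(\mathrm{curl};\Omega)$ that have the form $\mathbf a+\mathbf b\times \mathbf x$ with $\mathbf a,\mathbf b\in\mathbb R^3$ on each tetrahedron, and let $\mathbf w_{h,1},\dots,\mathbf w_{h,n_e}$ be its basis with $\int_{e_j}\mathbf w_{h,i}\cdot\boldsymbol\tau=\delta_{i,j}$. Let $\mathbf c^{(1)},\dots,\mathbf c^{(g)}\in\mathbb R^{2g}$ be linearly independent vectors with $$\oint_{\sigma_n}\Big(\sum_{\upsilon=1}^{2g}c^{(\lambda)}_\upsilon\mathbf w_{h,\upsilon}\Big)\cdot d\mathbf s=0\qquad(n,\lambda=1,\dots,g),$$ and set $$\boldsymbol\omega_{h,l}=\sum_{\upsilon=1}^{2g}c^{(l-g)}_\upsilon\mathbf w_{h,\upsilon}\ \ (l=g+1,\dots,2g),\qquad \boldsymbol\omega_{h,l}=\mathbf w_{h,l}\ \ (l=2g+1,\dots,n_Q).$$ Then the matrix $\mathbf K^\star=(K^\star_{ml})_{m,l=g+1}^{n_Q}$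 with entries $$K^\star_{ml}=\int_\Omega\boldsymbol\eta\,\mathrm{curl}\,\boldsymbol\omega_{h,l}\cdot\mathrm{curl}\,\boldsymbol\omega_{h,m}$$ is symmetric and positive definite. -/

import Mathlib

open MeasureTheory
open scoped ContDiff

noncomputable section

/-- Euclidean space `ℝ³`. -/
abbrev R3 : Type := EuclideanSpace ℝ (Fin 3)

namespace CurlDiv

/-! ### Domains, vector calculus, `H(curl; Ω)` -/

/-- The boundary of `Ω` is locally, in suitable Cartesian coordinates, the graph of a Lipschitz
function of two variables, with `Ω` on one side of it. -/
def HasLipschitzBoundary (Ω : Set R3) : Prop :=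
  ∀ x ∈ frontier Ω, ∃ (Φ : R3 ≃ᵃⁱ[ℝ] R3) (U : Set R3) (L : NNReal)
    (f : EuclideanSpace ℝ (Fin 2) → ℝ), IsOpen U ∧ x ∈ U ∧ LipschitzWith L f ∧
      ∀ y ∈ U, y ∈ Ω ↔ f !₂[Φ y 0, Φ y 1] < Φ y 2

/-- Bounded domain (nonempty connected open set) with Lipschitz boundary. -/
structure IsLipschitzDomain (Ω : Set R3) : Prop where
  isOpen : IsOpen Ω
  isConnected : IsConnected Ω
  isBounded : Bornology.IsBounded Ω
  lipschitz : HasLipschitzBoundary Ω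

/-- The cross product on `ℝ³`. -/
def cross (a b : R3) : R3 := WithLp.toLp 2 (crossProduct a.ofLp b.ofLp)

/-- `∂_i φ_j` at `x`. -/
def partialDeriv (φ : R3 → R3) (i j : Fin 3) (x : R3) : ℝ :=
  fderiv ℝ φ x (EuclideanSpace.single i 1) j

/-- The classical curl of a smooth field. -/
def smoothCurl (φ : R3 → R3) (x : R3) : R3 :=
  !₂[partialDeriv φ 1 2 x - partialDeriv φ 2 1 x,
     partialDeriv φ 2 0 x - partialDeriv φ 0 2 x,
     partialDeriv φ 0 1 x - partialDeriv φ 1 0 x]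

/-- `w` is the curl of `v` in `Ω` in the sense of distributions. -/
def IsWeakCurl (Ω : Set R3) (v w : R3 → R3) : Prop :=
  ∀ φ : R3 → R3, ContDiff ℝ ∞ φ → HasCompactSupport φ → tsupport φ ⊆ Ω →
    ∫ x in Ω, inner ℝ (v x) (smoothCurl φ x) = ∫ x in Ω, inner ℝ (w x) (φ x)

/-- `v ∈ (L²(Ω))³`. -/
def IsL2 (Ω : Set R3) (v : R3 → R3) : Prop := MemLp v 2 (volume.restrict Ω)

/-- `v ∈ H(curl; Ω)`. -/
def IsHCurl (Ω : Set R3) (v : R3 → R3) : Prop :=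
  IsL2 Ω v ∧ ∃ w, IsL2 Ω w ∧ IsWeakCurl Ω v w

open Classical in
/-- The curl of a field in `H(curl; Ω)`: its distributional curl, an `L²` field determined up to
a null set. -/
def curl (Ω : Set R3) (v : R3 → R3) : R3 → R3 :=
  if h : ∃ w, IsL2 Ω w ∧ IsWeakCurl Ω v w then h.choose else 0

/-- `η` is a symmetric matrix function with `L^∞(Ω)` entries, uniformly positive definite
in `Ω`. -/
structure IsAdmissibleCoeff (Ω : Set R3) (η : R3 → Matrix (Fin 3) (Fin 3) ℝ) : Prop where
  memLp_top : ∀ i j, MemLp (fun x => η x i j) ⊤ (volume.restrict Ω)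
  symm : ∀ᵐ x ∂(volume.restrict Ω), (η x).IsSymm
  coercive : ∃ α : ℝ, 0 < α ∧ ∀ᵐ x ∂(volume.restrict Ω), ∀ ξ : R3,
    α * ‖ξ‖ ^ 2 ≤ inner ℝ (Matrix.toEuclideanLin (η x) ξ) ξ

/-! ### Tetrahedral triangulations -/

/-- A tetrahedral triangulation of `closure Ω`, with a total ordering `v 0, …, v (nv - 1)` of its
vertices. -/
structure TetMesh (Ω : Set R3) where
  /-- the simplicial complex -/
  K : Geometry.SimplicialComplex ℝ R3
  finite : K.faces.Finite
  pure : ∀ s ∈ K.faces, ∃ t ∈ K.faces, s ⊆ t ∧ t.card = 4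
  space_eq : K.space = closure Ω
  /-- the number of vertices -/
  nv : ℕ
  /-- the numbering of the vertices -/
  v : Fin nv ≃ K.vertices

namespace TetMesh

variable {Ω : Set R3} (M : TetMesh Ω)

/-- The `i`-th vertex as a point. -/
def pt (i : Fin M.nv) : R3 := (M.v i : R3)

/-- The points of `S` are the vertices of a simplex of the triangulation. -/
def IsSimplex (S : Set R3) : Prop := ∃ s ∈ M.K.faces, (s : Set R3) = S

/-- The edges `[v_a, v_b]`, `a < b`, with the orientation given by the vertex ordering. -/
def Edge : Type :=
  {p : Fin M.nv × Fin M.nv // p.1 < p.2 ∧ M.IsSimplex {M.pt p.1, M.pt p.2}}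

/-- The triangular faces `[v_a, v_b, v_c]`, `a < b < c`. -/
def Face : Type :=
  {p : Fin M.nv × Fin M.nv × Fin M.nv // p.1 < p.2.1 ∧ p.2.1 < p.2.2 ∧
    M.IsSimplex {M.pt p.1, M.pt p.2.1, M.pt p.2.2}}

/-- The tetrahedra, given by their sets of vertices. -/
def Tet : Type := {t : Finset R3 // t ∈ M.K.faces ∧ t.card = 4}

instance : Finite M.Edge := Subtype.finite
instance : Finite M.Face := Subtype.finite
instance : Finite M.Tet :=
  (M.finite.subset (t := {t | t ∈ M.K.faces ∧ t.card = 4}) fun _ ht => ht.1).to_subtype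
instance : Fintype M.Edge := Fintype.ofFinite _
instance : Fintype M.Face := Fintype.ofFinite _
instance : Fintype M.Tet := Fintype.ofFinite _
instance : DecidableEq M.Edge := inferInstanceAs (DecidableEq (Subtype _))

variable {M}

/-- The initial vertex of an edge. -/
def Edge.tail (e : M.Edge) : Fin M.nv := e.1.1
/-- The final vertex of an edge. -/
def Edge.head (e : M.Edge) : Fin M.nv := e.1.2

/-- The edge `e` belongs to the tetrahedron `T`. -/
def Edge.MemTet (e : M.Edge) (T : M.Tet) : Prop := M.pt e.tail ∈ T.1 ∧ M.pt e.head ∈ T.1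

/-- The closed tetrahedron as a set of points. -/
def Tet.body (T : M.Tet) : Set R3 := convexHull ℝ (T.1 : Set R3)

/-! ### Simplicial homology in degree one -/

variable (M)

/-- Boundary of an oriented edge, `∂[v_a, v_b] = v_b - v_a`. -/
def edgeBoundary (e : M.Edge) : Fin M.nv → ℤ := fun i =>
  (if i = e.head then 1 else 0) - (if i = e.tail then 1 else 0)

/-- Boundary of an oriented face, `∂[v_a, v_b, v_c] = [v_b, v_c] - [v_a, v_c] + [v_a, v_b]`. -/
def faceBoundary (f : M.Face) : M.Edge → ℤ := fun e =>
  (if e.1 = (f.1.2.1, f.1.2.2) then 1 else 0) - (if e.1 = (f.1.1, f.1.2.2) then 1 else 0)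
    + (if e.1 = (f.1.1, f.1.2.1) then 1 else 0)

/-- The boundary operator from integer 1-chains to 0-chains. -/
def bdry₁ : (M.Edge → ℤ) →ₗ[ℤ] (Fin M.nv → ℤ) := Fintype.linearCombination ℤ M.edgeBoundary

/-- The 1-cycles supported on the set `P` of edges. -/
def cycles (P : Set M.Edge) : Submodule ℤ (M.Edge → ℤ) where
  carrier := {z | M.bdry₁ z = 0 ∧ ∀ e ∉ P, z e = 0}
  add_mem' := by
    rintro a b ⟨ha, ha'⟩ ⟨hb, hb'⟩
    exact ⟨by rw [map_add, ha, hb, add_zero], fun e he => by simp [ha' e he, hb' e he]⟩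
  zero_mem' := ⟨map_zero _, fun _ _ => rfl⟩
  smul_mem' := by
    rintro c a ⟨ha, ha'⟩
    exact ⟨by rw [map_smul, ha, smul_zero], fun e he => by simp [ha' e he]⟩

/-- The boundaries of the 2-chains supported on the set `Q` of faces. -/
def boundaries (Q : Set M.Face) : Submodule ℤ (M.Edge → ℤ) :=
  Submodule.span ℤ (M.faceBoundary '' Q)

variable {M} in
/-- The 1-chains `z i` are cycles of the subcomplex with edges `P` and faces `Q`, and their classes
form a `ℤ`-basis of its first homology group `cycles P / boundaries Q`. -/
structure IsHomologyBasis (P : Set M.Edge) (Q : Set M.Face) {ι : Type} (z : ι → M.Edge → ℤ) :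
    Prop where
  mem_cycles : ∀ i, z i ∈ M.cycles P
  linearIndependent : LinearIndependent ℤ fun i => (M.boundaries Q).mkQ (z i)
  span_eq : Submodule.span ℤ (Set.range fun i => (M.boundaries Q).mkQ (z i)) =
    (M.cycles P).map (M.boundaries Q).mkQ

/-- The edges lying on `∂Ω`. -/
def boundaryEdges : Set M.Edge :=
  {e | convexHull ℝ {M.pt e.tail, M.pt e.head} ⊆ frontier Ω}

/-- The faces lying on `∂Ω`. -/
def boundaryFaces : Set M.Face :=
  {f | convexHull ℝ {M.pt f.1.1, M.pt f.1.2.1, M.pt f.1.2.2} ⊆ frontier Ω}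

/-- The graph on all vertices of the triangulation with the edges in `P`. -/
def graph (P : Set M.Edge) : SimpleGraph (Fin M.nv) :=
  SimpleGraph.fromRel fun a b => ∃ e ∈ P, e.tail = a ∧ e.head = b

/-! ### Trees, cotrees and homology representatives -/

/-- The tree and the homological data underlying the construction of the finite element basis. -/
structure HomologyData (g : ℕ) where
  /-- the union of spanning trees of the connected components of the graph of the vertices and
  edges on `∂Ω` -/
  boundaryTree : Set M.Edge
  boundaryTree_subset : boundaryTree ⊆ M.boundaryEdges
  boundaryTree_isAcyclic : (M.graph boundaryTree).IsAcyclic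
  boundaryTree_spanning :
    (M.graph boundaryTree).Reachable = (M.graph M.boundaryEdges).Reachable
  /-- a spanning tree of the graph of all vertices and edges -/
  tree : Set M.Edge
  boundaryTree_subset_tree : boundaryTree ⊆ tree
  tree_isTree : (M.graph tree).IsTree
  /-- the closing edges `e_q` -/
  closing : Fin (2 * g) ↪ M.Edge
  closing_mem : ∀ q, closing q ∈ M.boundaryEdges
  closing_cotree : ∀ q, closing q ∉ tree
  /-- the 1-cycles `γ_q` on `∂Ω` -/
  γ : Fin (2 * g) → M.Edge → ℤ
  /-- `γ_q` consists of `e_q`, with coefficient one, and of edges of the boundary trees -/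
  γ_closed : ∀ q, ∀ e ∉ boundaryTree, γ q e = if e = closing q then 1 else 0
  γ_basis : IsHomologyBasis M.boundaryEdges M.boundaryFaces γ
  /-- the coefficients of the 1-cycles `σ_n` in terms of the `γ_q` -/
  A : Matrix (Fin g) (Fin (2 * g)) ℤ
  /-- the 1-cycles `σ_n` represent a basis of the first homology group of `closure Ω` -/
  σ_basis : IsHomologyBasis Set.univ Set.univ fun n => ∑ q, A n q • γ q

namespace HomologyData

variable {M} {g : ℕ} (D : M.HomologyData g)

/-- The 1-cycles `σ_n = ∑ A_{n,q} γ_q`. -/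
def σ (n : Fin g) : M.Edge → ℤ := ∑ q, D.A n q • D.γ q

/-- The cotree edges different from the closing edges. -/
def OtherCotree : Type := {e : M.Edge // e ∉ D.tree ∧ e ∉ Set.range D.closing}

instance : Finite D.OtherCotree := Subtype.finite
instance : Fintype D.OtherCotree := Fintype.ofFinite _

end HomologyData

/-! ### Edge elements of the lowest degree -/

/-- A field given piecewise, by its expression on each tetrahedron. -/
abbrev PiecewiseField : Type := M.Tet → R3 → R3

namespace PiecewiseField

variable {M}

open Classical in
/-- The field on `Ω`, defined off the null set formed by the faces of the tetrahedra. -/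
def toFun (u : M.PiecewiseField) (x : R3) : R3 :=
  ∑ T : M.Tet, if x ∈ interior T.body then u T x else 0

/-- `u` belongs to the Nédélec space `N_h`: it is of the form `a + b × x` on each tetrahedron and
belongs to `H(curl; Ω)`. -/
def IsNedelec (u : M.PiecewiseField) : Prop :=
  (∀ T, ∃ a b : R3, ∀ x, u T x = a + cross b x) ∧ IsHCurl Ω u.toFun

/-- The line integral `∫_e u · τ` of the expression of `u` on `T`. -/
def edgeIntegralOn (u : M.PiecewiseField) (T : M.Tet) (e : M.Edge) : ℝ :=
  ∫ t in (0 : ℝ)..1, inner ℝ (u T (M.pt e.tail + t • (M.pt e.head - M.pt e.tail)))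
    (M.pt e.head - M.pt e.tail)

open Classical in
/-- The line integral `∫_e u · τ`, computed from some tetrahedron containing `e` (for fields with
continuous tangential components, such as those in `N_h`, the choice does not matter). -/
def edgeIntegral (u : M.PiecewiseField) (e : M.Edge) : ℝ :=
  if h : ∃ T, e.MemTet T then u.edgeIntegralOn h.choose e else 0

/-- The line integral of `u` along an integer 1-chain. -/
def circulation (u : M.PiecewiseField) (z : M.Edge → ℤ) : ℝ :=
  ∑ e, (z e : ℝ) * u.edgeIntegral e

end PiecewiseField

variable {M}

/-- `w` is the basis of `N_h` dual to the edge integrals: `∫_{e'} w_e · τ = δ_{e,e'}`, where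
the line integral may be computed from any tetrahedron containing `e'`. -/
structure IsNedelecBasis (w : M.Edge → M.PiecewiseField) : Prop where
  isNedelec : ∀ e, (w e).IsNedelec
  dual : ∀ e e' T, e'.MemTet T → (w e).edgeIntegralOn T e' = if e = e' then 1 else 0

/-- The fields `ω_{h,l}`: the `g` combinations `∑_υ c^{(λ)}_υ w_υ` over the closing edges, and the
basis functions of the other cotree edges. -/
def omega {g : ℕ} (D : M.HomologyData g) (w : M.Edge → M.PiecewiseField)
    (c : Fin g → Fin (2 * g) → ℝ) : Fin g ⊕ D.OtherCotree → M.PiecewiseField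
  | Sum.inl i => ∑ υ, c i υ • w (D.closing υ)
  | Sum.inr e => w e.1

/-- The matrix `K*` with entries `K*_{ml} = ∫_Ω η curl ω_l · curl ω_m`. -/
def stiffness {g : ℕ} (D : M.HomologyData g) (w : M.Edge → M.PiecewiseField)
    (c : Fin g → Fin (2 * g) → ℝ) (η : R3 → Matrix (Fin 3) (Fin 3) ℝ) :
    Matrix (Fin g ⊕ D.OtherCotree) (Fin g ⊕ D.OtherCotree) ℝ :=
  Matrix.of fun m l => ∫ x in Ω, inner ℝ
    (Matrix.toEuclideanLin (η x) (curl Ω (omega D w c l).toFun x))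
    (curl Ω (omega D w c m).toFun x)

end TetMesh

end CurlDiv

end

/-!
Let `x` be a real vector indexed by the columns of `K*`, and put `U = ∑ l, x l • ω_l` and
`C = ∑ l, x l • curl ω_l`. Then `C` is a weak curl of `U`, and `xᵀ K* x = ∫_Ω η C · C` is at least
`α ‖C‖²_{L²}` with `α > 0` (`IsAdmissibleCoeff.integral_inner_pos`). So everything comes down to
showing that `C = 0` almost everywhere forces `x = 0`.

On a tetrahedron `U` has the form `a + b × x`, whose curl is `2 b`. Testing the weak curl with `ψ b`
for a bump function `ψ` gives `b = 0` (`eq_zero_of_isWeakCurl_zero`), so `U` is constant on every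
tetrahedron. The integral of a constant field around a triangle is zero; hence the edge integrals
of `U`, seen as a real simplicial 1-cochain, vanish on the boundary of every face
(`IsNedelecBasis.cochainEval_faceBoundary_eq_zero`). They vanish on the edges of the tree, because
only cotree basis functions enter `U`, and on the cycles `σ_n` by the hypothesis on `c`, as `σ_n`
contains no cotree edges other than the closing edges. Since the `σ_n` span the homology of
`closure Ω`, the cochain vanishes on all cycles, in particular on the cycle that a cotree edge
closes with the tree, and so on every edge (`HomologyData.cochain_eq_zero`). The edge integrals are
the coefficients of `U` in the basis `w`, and `x = 0` follows from the linear independence of `c`.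

The curl is only used through the fact that it is some weak curl in `L²`, so its uniqueness is not
needed.
-/

noncomputable section

namespace CurlDiv

namespace TetMesh

variable {Ω : Set R3} {M : TetMesh Ω}

/-! ### Cochains that vanish on the tree and on a homology basis -/

/-- The value `∑ e, z e * α e` of the real 1-cochain `α` on the integer 1-chain `z`. -/
def cochainEval (α : M.Edge → ℝ) : (M.Edge → ℤ) →ₗ[ℤ] ℝ := Fintype.linearCombination ℤ α

theorem cochainEval_apply (α : M.Edge → ℝ) (z : M.Edge → ℤ) :
    cochainEval α z = ∑ e, (z e : ℝ) * α e := by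
  simp [cochainEval, Fintype.linearCombination_apply]

/-- A path from `a` to `b` in the graph with edges `P` is a 1-chain supported on `P` with boundary
`b - a`. -/
theorem exists_chain_of_reachable {P : Set M.Edge} {a b : Fin M.nv}
    (h : (M.graph P).Reachable a b) :
    ∃ z : M.Edge → ℤ, (∀ e ∉ P, z e = 0) ∧ M.bdry₁ z = Pi.single b 1 - Pi.single a 1 := by
  have hbd : ∀ e : M.Edge, M.bdry₁ (Pi.single e 1) = Pi.single e.head 1 - Pi.single e.tail 1 := by
    intro e
    funext i
    simp [bdry₁, edgeBoundary, Pi.single_apply]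
  obtain ⟨p⟩ := h
  induction p with
  | nil => exact ⟨0, fun _ _ => rfl, by simp⟩
  | @cons a b c hab _ ih =>
    obtain ⟨z, hz, hzb⟩ := ih
    rw [graph, SimpleGraph.fromRel_adj] at hab
    rcases hab with ⟨-, ⟨e, heP, rfl, rfl⟩ | ⟨e, heP, rfl, rfl⟩⟩
    · refine ⟨z + Pi.single e 1, fun e' he' => ?_, ?_⟩
      · have : e' ≠ e := by rintro rfl; exact he' heP
        simp [hz e' he', this]
      · rw [map_add, hzb, hbd]; abel
    -- Here the path runs through `e` against its orientation.
    · refine ⟨z - Pi.single e 1, fun e' he' => ?_, ?_⟩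
      · have : e' ≠ e := by rintro rfl; exact he' heP
        simp [hz e' he', this]
      · rw [map_sub, hzb, hbd]; abel

/-- Modulo boundaries, on which `α` vanishes, every cycle is an integer combination of the cycles
of the homology basis. -/
theorem cochainEval_eq_zero_of_mem_cycles {P : Set M.Edge} {Q : Set M.Face} {ι : Type}
    {z : ι → M.Edge → ℤ} (hz : IsHomologyBasis P Q z) {α : M.Edge → ℝ}
    (hface : ∀ f ∈ Q, cochainEval α (M.faceBoundary f) = 0)
    (hα : ∀ i, cochainEval α (z i) = 0) {y : M.Edge → ℤ} (hy : y ∈ M.cycles P) :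
    cochainEval α y = 0 := by
  have hB : M.boundaries Q ≤ LinearMap.ker (cochainEval α) := by
    rw [boundaries, Submodule.span_le]
    rintro _ ⟨f, hf, rfl⟩
    exact hface f hf
  have hS : Submodule.span ℤ (Set.range z) ≤ LinearMap.ker (cochainEval α) := by
    rw [Submodule.span_le]
    rintro _ ⟨i, rfl⟩
    exact hα i
  have hmem : (M.boundaries Q).mkQ y ∈
      (Submodule.span ℤ (Set.range z)).map (M.boundaries Q).mkQ := by
    rw [Submodule.map_span, ← Set.range_comp]
    have := hz.span_eq
    simp only [Function.comp_def]
    rw [this]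
    exact Submodule.mem_map_of_mem hy
  obtain ⟨s, hs, hsy⟩ := hmem
  have hd : y - s ∈ M.boundaries Q := by
    rw [← Submodule.ker_mkQ (M.boundaries Q), LinearMap.mem_ker, map_sub, hsy, sub_self]
  have h1 := hB hd
  have h2 := hS hs
  rw [LinearMap.mem_ker] at h1 h2
  rw [map_sub, h2, sub_zero] at h1
  exact h1

/-- Every edge outside the tree closes a cycle with edges of the tree. As the cochain vanishes on
all cycles and on the tree, it vanishes on that edge. -/
theorem HomologyData.cochain_eq_zero {g : ℕ} (D : M.HomologyData g) {α : M.Edge → ℝ}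
    (htree : ∀ e ∈ D.tree, α e = 0)
    (hface : ∀ f, cochainEval α (M.faceBoundary f) = 0)
    (hσ : ∀ n, cochainEval α (D.σ n) = 0) (e : M.Edge) : α e = 0 := by
  obtain ⟨z, hz, hzb⟩ := exists_chain_of_reachable (D.tree_isTree.1.preconnected e.tail e.head)
  have hcyc : Pi.single e 1 - z ∈ M.cycles Set.univ := by
    refine ⟨?_, fun e he => (he trivial).elim⟩
    rw [map_sub, hzb, sub_eq_zero]
    funext i
    simp [bdry₁, edgeBoundary, Pi.single_apply]
  have h0 := cochainEval_eq_zero_of_mem_cycles D.σ_basis (fun f _ => hface f) hσ hcyc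
  have hz0 : cochainEval α z = 0 := by
    rw [cochainEval_apply]
    refine Finset.sum_eq_zero fun e' _ => ?_
    by_cases he' : e' ∈ D.tree
    · rw [htree e' he', mul_zero]
    · rw [hz e' he', Int.cast_zero, zero_mul]
  rw [map_sub, hz0, sub_zero] at h0
  simpa [cochainEval] using h0

/-! ### Edges, faces and interiors of tetrahedra -/

theorem IsSimplex.exists_tet {S : Set R3} (hS : M.IsSimplex S) : ∃ T : M.Tet, S ⊆ T.1 := by
  obtain ⟨s, hs, rfl⟩ := hS
  obtain ⟨t, ht, hst, hcard⟩ := M.pure s hs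
  exact ⟨⟨t, ht, hcard⟩, by exact_mod_cast hst⟩

theorem IsSimplex.mono {S S' : Set R3} (hS : M.IsSimplex S) (hS' : S' ⊆ S) (hne : S'.Nonempty) :
    M.IsSimplex S' := by
  obtain ⟨s, hs, rfl⟩ := hS
  lift S' to Finset R3 using s.finite_toSet.subset hS'
  exact ⟨S', M.K.down_closed hs (by exact_mod_cast hS') (by exact_mod_cast hne), rfl⟩

theorem Edge.exists_memTet (e : M.Edge) : ∃ T, e.MemTet T := by
  obtain ⟨T, hT⟩ := e.2.2.exists_tet
  exact ⟨T, hT (by simp [Edge.tail]), hT (by simp [Edge.head])⟩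

/-- A cochain that is, on each tetrahedron, the difference of the values of a linear form at the end
points of an edge is closed. -/
theorem cochainEval_faceBoundary {α : M.Edge → ℝ} (a : M.Tet → R3)
    (hα : ∀ e T, e.MemTet T → α e = inner ℝ (a T) (M.pt e.head - M.pt e.tail)) (f : M.Face) :
    cochainEval α (M.faceBoundary f) = 0 := by
  obtain ⟨⟨i, j, k⟩, hij, hjk, hS⟩ := f
  dsimp only at hij hjk hS
  obtain ⟨T, hT⟩ := hS.exists_tet
  let ejk : M.Edge := ⟨(j, k), hjk, hS.mono (by grind) (by simp)⟩
  let eik : M.Edge := ⟨(i, k), hij.trans hjk, hS.mono (by grind) (by simp)⟩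
  let eij : M.Edge := ⟨(i, j), hij, hS.mono (by grind) (by simp)⟩
  have hi : M.pt i ∈ T.1 := hT (by simp)
  have hj : M.pt j ∈ T.1 := hT (by simp)
  have hk : M.pt k ∈ T.1 := hT (by simp)
  have hb : M.faceBoundary ⟨(i, j, k), hij, hjk, hS⟩ =
      Pi.single ejk 1 - Pi.single eik 1 + Pi.single eij 1 := by
    have hsing : ∀ e e' : M.Edge,
        (Pi.single e' 1 : M.Edge → ℤ) e = if e.1 = e'.1 then 1 else 0 := by
      intro e e'
      rw [Pi.single_apply]
      exact if_congr Subtype.ext_iff rfl rfl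
    funext e
    simp only [Pi.add_apply, Pi.sub_apply, hsing]
    rfl
  have hs : ∀ e : M.Edge, cochainEval α (Pi.single e 1) = α e := fun e => by simp [cochainEval]
  rw [hb, map_add, map_sub, hs, hs, hs, hα ejk T ⟨hj, hk⟩, hα eik T ⟨hi, hk⟩, hα eij T ⟨hi, hj⟩]
  simp only [Edge.head, Edge.tail, ejk, eik, eij, inner_sub_right]
  ring

theorem Tet.body_subset (T : M.Tet) : T.body ⊆ closure Ω :=
  M.space_eq ▸ M.K.convexHull_subset_space T.2.1

/-- A tetrahedron has four affinely independent vertices, so it is not flat. -/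
theorem Tet.interior_body_nonempty (T : M.Tet) : (interior T.body).Nonempty := by
  rw [Tet.body, interior_convexHull_nonempty_iff_affineSpan_eq_top]
  have h := M.K.indep T.2.1
  have hc : Fintype.card T.1 = Module.finrank ℝ R3 + 1 := by
    simp [T.2.2]
  have := h.affineSpan_eq_top_iff_card_eq_finrank_add_one.2 hc
  simpa using this

/-- Two different tetrahedra meet in the convex hull of at most three points, which has no interior
points. -/
theorem Tet.eq_of_mem_interior {T T' : M.Tet} {x : R3} (hx : x ∈ interior T.body)
    (hx' : x ∈ interior T'.body) : T = T' := by
  classical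
  by_contra hne
  have hsub : interior T.body ∩ interior T'.body ⊆
      convexHull ℝ ((T.1 ∩ T'.1 : Finset R3) : Set R3) := by
    rw [Finset.coe_inter]
    exact (Set.inter_subset_inter interior_subset interior_subset).trans
      (M.K.inter_subset_convexHull T.2.1 T'.2.1)
  have hint : (interior (convexHull ℝ ((T.1 ∩ T'.1 : Finset R3) : Set R3))).Nonempty :=
    ⟨x, interior_maximal hsub (isOpen_interior.inter isOpen_interior) ⟨hx, hx'⟩⟩
  rw [interior_convexHull_nonempty_iff_affineSpan_eq_top] at hint
  have hind : AffineIndependent ℝ ((↑) : (T.1 ∩ T'.1 : Finset R3) → R3) :=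
    (M.K.indep T.2.1).mono (by simp)
  have hc := hind.affineSpan_eq_top_iff_card_eq_finrank_add_one.1 (by
    rwa [show Set.range ((↑) : (T.1 ∩ T'.1 : Finset R3) → R3) = _ from Subtype.range_coe])
  have hcard : (T.1 ∩ T'.1).card = 4 := by simpa using hc
  have h1 : T.1 ∩ T'.1 = T.1 :=
    Finset.eq_of_subset_of_card_le Finset.inter_subset_left (by rw [hcard, T.2.2])
  have h2 : T.1 ∩ T'.1 = T'.1 :=
    Finset.eq_of_subset_of_card_le Finset.inter_subset_right (by rw [hcard, T'.2.2])
  exact hne (Subtype.ext (h1.symm.trans h2))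

/-! ### Fields given piecewise -/

namespace PiecewiseField

theorem toFun_eq_of_mem_interior (u : M.PiecewiseField) {T : M.Tet} {x : R3}
    (hx : x ∈ interior T.body) : u.toFun x = u T x := by
  rw [toFun, Finset.sum_eq_single T]
  · rw [if_pos hx]
  · intro T' _ hne
    rw [if_neg fun hx' => hne (Tet.eq_of_mem_interior hx' hx)]
  · simp

theorem toFun_sum_smul {ι : Type*} [Fintype ι] (x : ι → ℝ) (u : ι → M.PiecewiseField) :
    toFun (∑ i, x i • u i) = ∑ i, x i • (u i).toFun := by
  funext p
  simp only [toFun, Finset.sum_apply, Pi.smul_apply, Finset.smul_sum]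
  rw [Finset.sum_comm]
  refine Finset.sum_congr rfl fun T _ => ?_
  split_ifs <;> simp

end PiecewiseField

end TetMesh

/-! ### Weak curls -/

theorem partialDeriv_eq {φ : R3 → R3} (hφ : ContDiff ℝ ∞ φ) (i j : Fin 3) (x : R3) :
    partialDeriv φ i j x = fderiv ℝ (fun y => φ y j) x (EuclideanSpace.single i 1) := by
  have hd : DifferentiableAt ℝ φ x := hφ.differentiable (by simp) x
  have h := ((EuclideanSpace.proj j : R3 →L[ℝ] ℝ).hasFDerivAt (x := φ x)).comp x hd.hasFDerivAt
  exact (DFunLike.congr_fun h.fderiv (EuclideanSpace.single i 1)).symm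

theorem continuous_partialDeriv {φ : R3 → R3} (hφ : ContDiff ℝ ∞ φ) (i j : Fin 3) :
    Continuous (partialDeriv φ i j) := by
  have h := (hφ.continuous_fderiv (by simp)).clm_apply
    (continuous_const (y := EuclideanSpace.single i (1 : ℝ)))
  exact (EuclideanSpace.proj j : R3 →L[ℝ] ℝ).continuous.comp h

theorem continuous_smoothCurl {φ : R3 → R3} (hφ : ContDiff ℝ ∞ φ) : Continuous (smoothCurl φ) := by
  have h := continuous_partialDeriv hφ
  refine (PiLp.continuous_toLp 2 _).comp (continuous_pi fun i => ?_)
  fin_cases i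
  · exact (h 1 2).sub (h 2 1)
  · exact (h 2 0).sub (h 0 2)
  · exact (h 0 1).sub (h 1 0)

theorem smoothCurl_eq_zero_of_notMem_tsupport {φ : R3 → R3} {x : R3} (hx : x ∉ tsupport φ) :
    smoothCurl φ x = 0 := by
  have h0 : fderiv ℝ φ x = 0 := by
    by_contra h
    exact hx (support_fderiv_subset ℝ h)
  ext i
  fin_cases i <;> simp [smoothCurl, partialDeriv, h0]

theorem hasCompactSupport_smoothCurl {φ : R3 → R3} (hc : HasCompactSupport φ) :
    HasCompactSupport (smoothCurl φ) :=
  HasCompactSupport.intro hc fun _ => smoothCurl_eq_zero_of_notMem_tsupport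

theorem IsL2.integrable_inner {Ω : Set R3} {v w : R3 → R3} (hv : IsL2 Ω v) (hw : IsL2 Ω w) :
    Integrable (fun x => inner ℝ (v x) (w x)) (volume.restrict Ω) := by
  have h := L2.integrable_inner (𝕜 := ℝ) hv.toLp hw.toLp
  refine h.congr ?_
  filter_upwards [hv.coeFn_toLp, hw.coeFn_toLp] with x h1 h2
  rw [h1, h2]

theorem isL2_of_continuous_of_hasCompactSupport {Ω : Set R3} {φ : R3 → R3} (hφ : Continuous φ)
    (hc : HasCompactSupport φ) : IsL2 Ω φ :=
  (hφ.memLp_of_hasCompactSupport hc).restrict Ω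

theorem isL2_sum_smul {Ω : Set R3} {ι : Type*} [Fintype ι] (x : ι → ℝ) {v : ι → R3 → R3}
    (hv : ∀ i, IsL2 Ω (v i)) : IsL2 Ω (∑ i, x i • v i) :=
  memLp_finsetSum' _ fun i _ => (hv i).const_smul (x i)

theorem IsWeakCurl.sum_smul {Ω : Set R3} {ι : Type*} [Fintype ι] (x : ι → ℝ) {v w : ι → R3 → R3}
    (hv : ∀ i, IsL2 Ω (v i)) (hw : ∀ i, IsL2 Ω (w i)) (h : ∀ i, IsWeakCurl Ω (v i) (w i)) :
    IsWeakCurl Ω (∑ i, x i • v i) (∑ i, x i • w i) := by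
  intro φ hφ hc hs
  have hL : ∀ {u : ι → R3 → R3} {ψ : R3 → R3}, (∀ i, IsL2 Ω (u i)) → IsL2 Ω ψ →
      ∫ p in Ω, inner ℝ ((∑ i, x i • u i) p) (ψ p) =
        ∑ i, x i * ∫ p in Ω, inner ℝ (u i p) (ψ p) := by
    intro u ψ hu hψ
    simp only [Finset.sum_apply, Pi.smul_apply, sum_inner, real_inner_smul_left]
    rw [integral_finsetSum _ fun i _ => ((hu i).integrable_inner hψ).const_mul (x i)]
    simp only [integral_const_mul]
  rw [hL hv (isL2_of_continuous_of_hasCompactSupport (continuous_smoothCurl hφ)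
    (hasCompactSupport_smoothCurl hc)), hL hw
    (isL2_of_continuous_of_hasCompactSupport hφ.continuous hc)]
  exact Finset.sum_congr rfl fun i _ => by rw [h i φ hφ hc hs]

/-- For a field in `H(curl; Ω)` the `curl` is given by the choice of an `L²` weak curl, not by the
default value zero. -/
theorem IsHCurl.curl_spec {Ω : Set R3} {v : R3 → R3} (hv : IsHCurl Ω v) :
    IsL2 Ω (curl Ω v) ∧ IsWeakCurl Ω v (curl Ω v) := by
  rw [curl, dif_pos hv.2]
  exact hv.2.choose_spec

/-- Integration by parts against an affine function. -/
theorem integral_affine_mul_partialDeriv {φ : R3 → R3} (hφ : ContDiff ℝ ∞ φ)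
    (hc : HasCompactSupport φ) (c : ℝ) (L : R3 →L[ℝ] ℝ) (i j : Fin 3) :
    Integrable (fun x => (c + L x) * partialDeriv φ i j x) ∧
    ∫ x, (c + L x) * partialDeriv φ i j x = -(L (EuclideanSpace.single i 1) * ∫ x, φ x j) := by
  have hcj : HasCompactSupport fun y => φ y j :=
    hc.comp_left (g := fun v : R3 => v j) rfl
  have hφj : ContDiff ℝ ∞ fun y => φ y j :=
    (EuclideanSpace.proj j : R3 →L[ℝ] ℝ).contDiff.comp hφ
  have hf : Differentiable ℝ fun x : R3 => c + L x := by fun_prop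
  have hfc : Continuous fun x : R3 => c + L x := by fun_prop
  have hfd : ∀ x, fderiv ℝ (fun x : R3 => c + L x) x = L := fun x => by
    rw [fderiv_const_add, ContinuousLinearMap.fderiv]
  have hcd : HasCompactSupport fun x => fderiv ℝ (fun y => φ y j) x (EuclideanSpace.single i 1) :=
    (hcj.fderiv (𝕜 := ℝ)).comp_left (g := fun l : R3 →L[ℝ] ℝ => l (EuclideanSpace.single i 1)) rfl
  have hcont : Continuous fun x => fderiv ℝ (fun y => φ y j) x (EuclideanSpace.single i 1) :=
    (hφj.continuous_fderiv (by simp)).clm_apply continuous_const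
  simp only [partialDeriv_eq hφ]
  have hI : Integrable
      (fun x => (c + L x) * fderiv ℝ (fun y => φ y j) x (EuclideanSpace.single i 1)) :=
    (hfc.mul hcont).integrable_of_hasCompactSupport hcd.mul_left
  refine ⟨hI, ?_⟩
  rw [integral_mul_fderiv_eq_neg_fderiv_mul_of_integrable
    (f := fun x : R3 => c + L x) (g := fun y => φ y j) ?_ hI
    ((hfc.mul hφj.continuous).integrable_of_hasCompactSupport hcj.mul_left)
    (fun x _ => hf x) (fun x _ => hφj.differentiable (by simp) x)]
  · simp only [hfd, integral_const_mul]
  · simp only [hfd]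
    exact (hφj.continuous.integrable_of_hasCompactSupport hcj).const_mul _

/-- The curl of `a + b × x` is `2 b`. -/
theorem integral_inner_add_cross_smoothCurl {φ : R3 → R3} (hφ : ContDiff ℝ ∞ φ)
    (hc : HasCompactSupport φ) (a b : R3) :
    ∫ x, inner ℝ (a + cross b x) (smoothCurl φ x) = 2 * ∫ x, inner ℝ b (φ x) := by
  let P : Fin 3 → R3 →L[ℝ] ℝ := fun j => EuclideanSpace.proj j
  have key := integral_affine_mul_partialDeriv hφ hc
  have hφj : ∀ j, Integrable fun x => φ x j := fun j =>
    ((EuclideanSpace.proj j : R3 →L[ℝ] ℝ).continuous.comp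
      hφ.continuous).integrable_of_hasCompactSupport (hc.comp_left (g := fun v : R3 => v j) rfl)
  -- The linear parts of the components of `a + b × x`.
  let L0 := b 1 • P 2 - b 2 • P 1
  let L1 := b 2 • P 0 - b 0 • P 2
  let L2 := b 0 • P 1 - b 1 • P 0
  have hexp : ∀ x, inner ℝ (a + cross b x) (smoothCurl φ x) =
      ((a 0 + L0 x) * partialDeriv φ 1 2 x - (a 0 + L0 x) * partialDeriv φ 2 1 x) +
      ((a 1 + L1 x) * partialDeriv φ 2 0 x - (a 1 + L1 x) * partialDeriv φ 0 2 x) +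
      ((a 2 + L2 x) * partialDeriv φ 0 1 x - (a 2 + L2 x) * partialDeriv φ 1 0 x) := by
    intro x
    simp [PiLp.inner_apply, Fin.sum_univ_three, cross, smoothCurl, cross_apply, L0, L1, L2, P]
    ring
  have hexp' : ∀ x, inner ℝ b (φ x) = b 0 * φ x 0 + b 1 * φ x 1 + b 2 * φ x 2 := by
    intro x
    simp [PiLp.inner_apply, Fin.sum_univ_three, mul_comm]
  simp only [hexp, hexp']
  rw [integral_add, integral_add, integral_sub, integral_sub, integral_sub, integral_add,
    integral_add, integral_const_mul, integral_const_mul, integral_const_mul,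
    (key _ _ _ _).2, (key _ _ _ _).2, (key _ _ _ _).2, (key _ _ _ _).2, (key _ _ _ _).2,
    (key _ _ _ _).2]
  · simp [L0, L1, L2, P]
    ring
  all_goals
    first
      | exact (key _ _ _ _).1
      | exact (hφj _).const_mul _
      | exact ((hφj _).const_mul _).add ((hφj _).const_mul _)
      | exact (key _ _ _ _).1.sub (key _ _ _ _).1
      | exact ((key _ _ _ _).1.sub (key _ _ _ _).1).add ((key _ _ _ _).1.sub (key _ _ _ _).1)

/-- Testing with `ψ b`, where `ψ` is a bump function in the open set `O`, gives
`2 ‖b‖² ∫ ψ = 0`. -/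
theorem eq_zero_of_isWeakCurl_zero {Ω O : Set R3} (hO : IsOpen O) (hne : O.Nonempty)
    (hOΩ : O ⊆ Ω) {v w : R3 → R3} (h : IsWeakCurl Ω v w) (hw : w =ᵐ[volume.restrict Ω] 0)
    {a b : R3} (hv : ∀ x ∈ O, v x = a + cross b x) : b = 0 := by
  obtain ⟨x₀, hx₀⟩ := hne
  obtain ⟨ψ, hψs, hψc, hψ, hψr, hψ1⟩ :=
    exists_contDiff_tsupport_subset (E := R3) (n := ⊤) (hO.mem_nhds hx₀)
  let φ : R3 → R3 := fun x => ψ x • b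
  have hφ : ContDiff ℝ ∞ φ := hψ.smul contDiff_const
  have hφc : HasCompactSupport φ := hψc.smul_right
  have hφs : tsupport φ ⊆ O := 
    (tsupport_smul_subset_left ψ fun _ : R3 => b).trans hψs
  have h1 := h φ hφ hφc (hφs.trans hOΩ)
  have h2 : ∫ x in Ω, inner ℝ (w x) (φ x) = 0 := by
    refine integral_eq_zero_of_ae ?_
    filter_upwards [hw] with x hx
    simp [hx]
  have h3 : ∫ x in Ω, inner ℝ (v x) (smoothCurl φ x) =
      ∫ x, inner ℝ (a + cross b x) (smoothCurl φ x) := by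
    rw [← setIntegral_eq_integral_of_forall_compl_eq_zero (s := Ω)
      (f := fun x => inner ℝ (a + cross b x) (smoothCurl φ x))]
    · refine integral_congr_ae (Filter.Eventually.of_forall fun x => ?_)
      by_cases hx : x ∈ O
      · simp only [hv x hx]
      · simp [smoothCurl_eq_zero_of_notMem_tsupport fun hx' => hx (hφs hx')]
    · intro x hx
      rw [smoothCurl_eq_zero_of_notMem_tsupport fun hx' => hx (hOΩ (hφs hx')), inner_zero_right]
  rw [h2, h3, integral_inner_add_cross_smoothCurl hφ hφc] at h1
  simp only [φ, real_inner_smul_right, integral_mul_const, real_inner_self_eq_norm_sq] at h1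
  have hpos : 0 < ∫ x, ψ x := hψ.continuous.integral_pos_of_hasCompactSupport_nonneg_nonzero hψc
    (fun x => (hψr ⟨x, rfl⟩).1) (x := x₀) (by simp [hψ1])
  simpa [hpos.ne'] using h1

/-! ### The energy form -/

namespace IsAdmissibleCoeff

variable {Ω : Set R3} {η : R3 → Matrix (Fin 3) (Fin 3) ℝ}

theorem isL2_mul (hη : IsAdmissibleCoeff Ω η) {v : R3 → R3} (hv : IsL2 Ω v) :
    IsL2 Ω fun x => Matrix.toEuclideanLin (η x) (v x) := by
  refine MemLp.of_eval_piLp fun i => ?_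
  simp only [Matrix.ofLp_toLpLin, Matrix.toLin'_apply, Matrix.mulVec, dotProduct]
  exact memLp_finsetSum _ fun j _ =>
    MemLp.mul' (p := ⊤) (q := 2) (hv.eval_piLp j) (hη.memLp_top i j)

theorem integral_inner_comm (hη : IsAdmissibleCoeff Ω η) (v w : R3 → R3) :
    ∫ x in Ω, inner ℝ (Matrix.toEuclideanLin (η x) (v x)) (w x) =
      ∫ x in Ω, inner ℝ (Matrix.toEuclideanLin (η x) (w x)) (v x) := by
  refine integral_congr_ae ?_
  filter_upwards [hη.symm] with x hx
  have hs : (Matrix.toEuclideanLin (η x)).IsSymmetric :=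
    Matrix.isSymmetric_toEuclideanLin_iff.2 (by
      rwa [Matrix.IsHermitian, Matrix.conjTranspose_eq_transpose_of_trivial])
  rw [hs, real_inner_comm]

theorem integral_inner_sum_smul (hη : IsAdmissibleCoeff Ω η) {ι : Type*} [Fintype ι] (y : ι → ℝ)
    {v : ι → R3 → R3} (hv : ∀ i, IsL2 Ω (v i)) :
    ∫ x in Ω, inner ℝ (Matrix.toEuclideanLin (η x) ((∑ i, y i • v i) x)) ((∑ i, y i • v i) x) =
      ∑ i, ∑ j, y i * y j * ∫ x in Ω, inner ℝ (Matrix.toEuclideanLin (η x) (v j x)) (v i x) := by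
  have hI : ∀ i j, Integrable (fun x => y i * y j *
      inner ℝ (Matrix.toEuclideanLin (η x) (v j x)) (v i x)) (volume.restrict Ω) := fun i j =>
    ((hη.isL2_mul (hv j)).integrable_inner (hv i)).const_mul _
  simp only [← integral_const_mul]
  simp only [← integral_finsetSum _ fun j _ => hI _ j]
  rw [← integral_finsetSum _ fun i _ => integrable_finsetSum _ fun j _ => hI i j]
  refine integral_congr_ae (Filter.Eventually.of_forall fun x => ?_)
  simp only [Finset.sum_apply, Pi.smul_apply, map_sum, map_smul, sum_inner, inner_sum,
    real_inner_smul_left, real_inner_smul_right]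
  exact Finset.sum_congr rfl fun i _ => Finset.sum_congr rfl fun j _ => by ring

theorem integral_inner_pos (hη : IsAdmissibleCoeff Ω η) {v : R3 → R3} (hv : IsL2 Ω v)
    (hne : ¬ v =ᵐ[volume.restrict Ω] 0) :
    0 < ∫ x in Ω, inner ℝ (Matrix.toEuclideanLin (η x) (v x)) (v x) := by
  obtain ⟨α, hα, hco⟩ := hη.coercive
  have h0 : 0 ≤ᵐ[volume.restrict Ω] fun x => inner ℝ (Matrix.toEuclideanLin (η x) (v x)) (v x) := by
    filter_upwards [hco] with x hx
    exact (by positivity : (0 : ℝ) ≤ α * ‖v x‖ ^ 2).trans (hx (v x))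
  refine lt_of_le_of_ne (integral_nonneg_of_ae h0) fun h => hne ?_
  have hz := (integral_eq_zero_iff_of_nonneg_ae h0
    ((hη.isL2_mul hv).integrable_inner hv)).1 h.symm
  filter_upwards [hz, hco] with x hx hcx
  have h1 := hcx (v x)
  rw [hx] at h1
  have h2 : ‖v x‖ ^ 2 ≤ 0 := nonpos_of_mul_nonpos_right h1 hα
  exact norm_eq_zero.1 (sq_nonpos_iff _ |>.1 h2)

end IsAdmissibleCoeff

namespace TetMesh

variable {Ω : Set R3} {M : TetMesh Ω}

/-! ### Combinations of the Nédélec basis functions -/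

namespace PiecewiseField

theorem isHCurl_sum_smul {ι : Type*} [Fintype ι] (x : ι → ℝ) {u : ι → M.PiecewiseField}
    (hu : ∀ i, IsHCurl Ω (u i).toFun) : IsHCurl Ω (toFun (∑ i, x i • u i)) := by
  rw [toFun_sum_smul]
  exact ⟨isL2_sum_smul x fun i => (hu i).1, _, isL2_sum_smul x fun i => (hu i).curl_spec.1,
    IsWeakCurl.sum_smul x (fun i => (hu i).1) (fun i => (hu i).curl_spec.1)
      fun i => (hu i).curl_spec.2⟩

theorem continuous_of_eq_add_cross {f : R3 → R3} (hf : ∃ a b : R3, ∀ x, f x = a + cross b x) :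
    Continuous f := by
  obtain ⟨a, b, h⟩ := hf
  rw [funext h]
  refine continuous_const.add ((PiLp.continuous_toLp 2 _).comp ?_)
  exact (LinearMap.continuous_of_finiteDimensional (crossProduct b.ofLp)).comp
    (PiLp.continuous_ofLp 2 _)

theorem exists_sum_smul_eq_add_cross {ι : Type*} [Fintype ι] (x : ι → ℝ) {f : ι → R3 → R3}
    (hf : ∀ i, ∃ a b : R3, ∀ p, f i p = a + cross b p) :
    ∃ a b : R3, ∀ p, (∑ i, x i • f i) p = a + cross b p := by
  choose a b h using hf
  refine ⟨∑ i, x i • a i, ∑ i, x i • b i, fun p => ?_⟩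
  have hc : cross (∑ i, x i • b i) p = ∑ i, x i • cross (b i) p := by
    simp [cross, WithLp.ofLp_sum, WithLp.toLp_sum]
  rw [hc, ← Finset.sum_add_distrib]
  simp [h]

theorem edgeIntegralOn_sum_smul {ι : Type*} [Fintype ι] (x : ι → ℝ) {u : ι → M.PiecewiseField}
    {T : M.Tet} (hu : ∀ i, Continuous (u i T)) (e : M.Edge) :
    edgeIntegralOn (∑ i, x i • u i) T e = ∑ i, x i * (u i).edgeIntegralOn T e := by
  simp only [edgeIntegralOn, Finset.sum_apply, Pi.smul_apply, sum_inner, real_inner_smul_left]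
  rw [intervalIntegral.integral_finsetSum]
  · simp only [intervalIntegral.integral_const_mul]
  · intro i _
    have := hu i
    exact Continuous.intervalIntegrable (by fun_prop) _ _

theorem edgeIntegralOn_of_eq_const {u : M.PiecewiseField} {T : M.Tet} {a : R3}
    (hu : ∀ x, u T x = a) (e : M.Edge) :
    u.edgeIntegralOn T e = inner ℝ a (M.pt e.head - M.pt e.tail) := by
  simp [edgeIntegralOn, hu]

end PiecewiseField

namespace IsNedelecBasis

variable {w : M.Edge → M.PiecewiseField}

theorem edgeIntegralOn_sum_smul (hw : IsNedelecBasis w) (α : M.Edge → ℝ) {e : M.Edge} {T : M.Tet}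
    (he : e.MemTet T) :
    (∑ e', α e' • w e').edgeIntegralOn T e = α e := by
  rw [PiecewiseField.edgeIntegralOn_sum_smul α fun e' =>
    PiecewiseField.continuous_of_eq_add_cross ((hw.isNedelec e').1 T)]
  simp [hw.dual _ e T he]

/-- The edge integrals of `∑ e, α e • w e` may be computed on any tetrahedron, in particular on the
one chosen in `edgeIntegral`. -/
theorem circulation_sum_smul (hw : IsNedelecBasis w) (α : M.Edge → ℝ) (z : M.Edge → ℤ) :
    (∑ e, α e • w e).circulation z = cochainEval α z := by
  rw [cochainEval_apply, PiecewiseField.circulation]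
  refine Finset.sum_congr rfl fun e _ => ?_
  rw [PiecewiseField.edgeIntegral, dif_pos e.exists_memTet,
    hw.edgeIntegralOn_sum_smul α e.exists_memTet.choose_spec]

/-- A curl-free field of `N_h` is constant on each tetrahedron, hence its edge integrals form a
closed cochain. -/
theorem cochainEval_faceBoundary_eq_zero (hw : IsNedelecBasis w) (hΩ : IsOpen Ω)
    {α : M.Edge → ℝ} {C : R3 → R3}
    (hC : IsWeakCurl Ω (∑ e, α e • w e).toFun C) (hC0 : C =ᵐ[volume.restrict Ω] 0) (f : M.Face) :
    cochainEval α (M.faceBoundary f) = 0 := by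
  have hconst : ∀ T, ∃ a : R3, ∀ x, (∑ e, α e • w e) T x = a := by
    intro T
    obtain ⟨a, b, hab⟩ := PiecewiseField.exists_sum_smul_eq_add_cross α
      fun e => (hw.isNedelec e).1 T
    have hsum : (∑ e, α e • w e) T = ∑ e, α e • w e T := by simp
    have hne : (interior T.body ∩ Ω).Nonempty := by
      obtain ⟨x, hx⟩ := T.interior_body_nonempty
      -- Only `T.body ⊆ closure Ω` is known, but an open set that meets `closure Ω` meets `Ω`.
      exact mem_closure_iff.1 (T.body_subset (interior_subset hx)) _ isOpen_interior hx
    have hb : b = 0 := by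
      refine eq_zero_of_isWeakCurl_zero (isOpen_interior.inter hΩ) hne Set.inter_subset_right hC hC0
        (a := a) fun x hx => ?_
      rw [PiecewiseField.toFun_eq_of_mem_interior _ hx.1, hsum, hab]
    refine ⟨a, fun x => ?_⟩
    rw [hsum, hab, hb]
    simp [cross]
  choose a ha using hconst
  refine cochainEval_faceBoundary a (fun e T he => ?_) f
  rw [← PiecewiseField.edgeIntegralOn_of_eq_const (ha T), hw.edgeIntegralOn_sum_smul α he]

end IsNedelecBasis

namespace HomologyData

variable {g : ℕ} (D : M.HomologyData g)

/-- The coefficients of `ω_{h,l}` in the basis of `N_h`. -/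
def omegaCoeff (c : Fin g → Fin (2 * g) → ℝ) : Fin g ⊕ D.OtherCotree → M.Edge → ℝ
  | Sum.inl i => ∑ υ, c i υ • Pi.single (D.closing υ) 1
  | Sum.inr e => Pi.single e.1 1

variable (c : Fin g → Fin (2 * g) → ℝ)

theorem omega_eq_sum_omegaCoeff (w : M.Edge → M.PiecewiseField) (l : Fin g ⊕ D.OtherCotree) :
    omega D w c l = ∑ e, D.omegaCoeff c l e • w e := by
  rcases l with i | o
  · simp only [omega, omegaCoeff, Finset.sum_apply, Pi.smul_apply, smul_eq_mul, Finset.sum_smul]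
    rw [Finset.sum_comm]
    simp [Pi.single_apply]
  · simp [omega, omegaCoeff, Pi.single_apply]

theorem omegaCoeff_eq_zero_of_mem_tree {e : M.Edge} (he : e ∈ D.tree)
    (l : Fin g ⊕ D.OtherCotree) : D.omegaCoeff c l e = 0 := by
  rcases l with i | o
  · simp only [omegaCoeff, Finset.sum_apply, Pi.smul_apply]
    refine Finset.sum_eq_zero fun υ _ => ?_
    have : e ≠ D.closing υ := by rintro rfl; exact D.closing_cotree υ he
    simp [this]
  · have : e ≠ o.1 := by rintro rfl; exact o.2.1 he
    simp [omegaCoeff, this]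

/-- A cotree edge other than the closing edges does not occur in the cycles `σ_n`, which are made of
closing edges and edges of the boundary trees. -/
theorem cochainEval_single_other (o : D.OtherCotree) (n : Fin g) :
    cochainEval (Pi.single o.1 1) (D.σ n) = 0 := by
  have hγ : ∀ q, D.γ q o.1 = 0 := fun q => by
    rw [D.γ_closed q o.1 fun h => o.2.1 (D.boundaryTree_subset_tree h),
      if_neg fun h => o.2.2 ⟨q, h.symm⟩]
  simp [cochainEval_apply, Pi.single_apply, σ, hγ]

/-- The fields `ω_{h,l}` have linearly independent coefficient vectors. -/
theorem eq_zero_of_sum_smul_omegaCoeff (hc : LinearIndependent ℝ c)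
    {x : Fin g ⊕ D.OtherCotree → ℝ} (hx : ∀ e, ∑ l, x l * D.omegaCoeff c l e = 0) : x = 0 := by
  have hr : ∀ o, x (Sum.inr o) = 0 := by
    intro o
    have h := hx o.1
    have h1 : ∀ i υ, c i υ * (Pi.single (D.closing υ) 1 : M.Edge → ℝ) o.1 = 0 := fun i υ => by
      rw [Pi.single_eq_of_ne fun h => o.2.2 ⟨υ, h.symm⟩, mul_zero]
    rw [Fintype.sum_sum_type] at h
    simp only [omegaCoeff, Finset.sum_apply, Pi.smul_apply, smul_eq_mul, h1, Finset.sum_const_zero,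
      mul_zero, zero_add] at h
    rw [Finset.sum_eq_single o] at h
    · simpa using h
    · intro o' _ hne
      rw [Pi.single_eq_of_ne fun h => hne (Subtype.ext h.symm), mul_zero]
    · simp
  have hl : ∑ i, x (Sum.inl i) • c i = 0 := by
    funext υ
    have h := hx (D.closing υ)
    rw [Fintype.sum_sum_type] at h
    simpa [omegaCoeff, hr, Pi.single_apply] using h
  have hl' := Fintype.linearIndependent_iff.1 hc _ hl
  funext l
  rcases l with i | o
  exacts [hl' i, hr o]

end HomologyData

end TetMesh

end CurlDiv

end

theorem mainTheorem3 (Ω : Set R3) (hΩ : CurlDiv.IsLipschitzDomain Ω)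
    (η : R3 → Matrix (Fin 3) (Fin 3) ℝ) (hη : CurlDiv.IsAdmissibleCoeff Ω η)
    (M : CurlDiv.TetMesh Ω) (g : ℕ) (D : M.HomologyData g)
    (w : M.Edge → M.PiecewiseField) (hw : CurlDiv.TetMesh.IsNedelecBasis w)
    (c : Fin g → Fin (2 * g) → ℝ) (hc : LinearIndependent ℝ c)
    (hcσ : ∀ i n, CurlDiv.TetMesh.PiecewiseField.circulation
      (∑ υ, c i υ • w (D.closing υ)) (D.σ n) = 0) :
    (CurlDiv.TetMesh.stiffness D w c η).IsSymm ∧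
      (CurlDiv.TetMesh.stiffness D w c η).PosDef := by
  have hsymm : (CurlDiv.TetMesh.stiffness D w c η).IsSymm := by
    ext m l
    exact hη.integral_inner_comm _ _
  refine ⟨hsymm, Matrix.PosDef.of_dotProduct_mulVec_pos ?_ fun x hx => ?_⟩
  · rwa [Matrix.IsHermitian, Matrix.conjTranspose_eq_transpose_of_trivial]
  have hcurl : ∀ l, CurlDiv.IsHCurl Ω (CurlDiv.TetMesh.omega D w c l).toFun := fun l => by
    rw [D.omega_eq_sum_omegaCoeff c w l]
    exact CurlDiv.TetMesh.PiecewiseField.isHCurl_sum_smul _ fun e => (hw.isNedelec e).2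
  have hquad : star x ⬝ᵥ (CurlDiv.TetMesh.stiffness D w c η).mulVec x =
      ∑ m, ∑ l, x m * x l * CurlDiv.TetMesh.stiffness D w c η m l := by
    simp only [dotProduct, Matrix.mulVec, Finset.mul_sum, star_trivial]
    exact Finset.sum_congr rfl fun m _ => Finset.sum_congr rfl fun l _ => by ring
  have hform := hη.integral_inner_sum_smul x fun l => (hcurl l).curl_spec.1
  have hL2 := CurlDiv.isL2_sum_smul x fun l => (hcurl l).curl_spec.1
  -- If the energy vanishes, so does the cochain of the edge integrals of `∑ l, x l • ω_l`.
  refine hquad.trans hform.symm ▸ hη.integral_inner_pos hL2 fun hzero => hx ?_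
  refine D.eq_zero_of_sum_smul_omegaCoeff c hc (D.cochain_eq_zero ?_ ?_ ?_)
  · intro e he
    exact Finset.sum_eq_zero fun l _ => by rw [D.omegaCoeff_eq_zero_of_mem_tree c he, mul_zero]
  · refine hw.cochainEval_faceBoundary_eq_zero hΩ.isOpen ?_ hzero
    have hU : (∑ e, (∑ l, x l * D.omegaCoeff c l e) • w e) =
        ∑ l, x l • CurlDiv.TetMesh.omega D w c l := by
      simp only [D.omega_eq_sum_omegaCoeff c w, Finset.smul_sum, Finset.sum_smul, mul_smul]
      exact Finset.sum_comm
    rw [hU, CurlDiv.TetMesh.PiecewiseField.toFun_sum_smul]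
    exact CurlDiv.IsWeakCurl.sum_smul x (fun l => (hcurl l).1)
      (fun l => (hcurl l).curl_spec.1) fun l => (hcurl l).curl_spec.2
  · intro n
    have hl : ∀ l, CurlDiv.TetMesh.cochainEval (D.omegaCoeff c l) (D.σ n) = 0 := by
      rintro (i | o)
      · rw [← hw.circulation_sum_smul, ← D.omega_eq_sum_omegaCoeff c w]
        exact hcσ i n
      · exact D.cochainEval_single_other o n
    simp only [CurlDiv.TetMesh.cochainEval_apply, Finset.mul_sum] at hl ⊢
    rw [Finset.sum_comm]
    refine Finset.sum_eq_zero fun l _ => ?_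
    rw [← mul_zero (x l), ← hl l, Finset.mul_sum]
    exact Finset.sum_congr rfl fun e _ => by ring
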